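/- Let $(\Omega,\mathcal F,\mathbb Q)$ be a probability space with a filtration $\mathbb F=(\mathcal F_t)_{t\ge 0}$, where $\mathbb Q$ is the risk-neutral measure. Let $f$ be a deterministic real function on $[0,\infty)$, and let $\lambda_{Y_1},\lambda_{Y_2},\lambda_{J_1},\lambda_{J_2}>0$, $\phi_{1},\phi_{2},\sigma_{1},\sigma_{2}\in\mathbb R$, $\theta_1,\theta_2\ge 0$ and $\beta_1^*,\beta_2^*>0$ be constants. Under $\mathbb Q$, for $i=1,2$, let $W_i$ be a standard $\mathbb F$-Brownian motion and let $\Pi_i$ be an $\mathbb F$-compound Poisson process with intensity $\theta_i$ and exponentially distributed jump sizes with rate $\beta_i^*$ (mean $1/\beta_i^*$); that is, each of these processes is $\mathbb F$-adapted and its increments over $[s,t]$ are independent of $\mathcal F_s$. (No independence between the four driving processes is required.) Let $Y_i,J_i$ be $\mathbb F$-adapted solutions of \[ dY_i(t)=\bigl(-\lambda_{Y_i}^{-1}Y_i(t)-\phi_i\bigr)\,dt+\sigma_i\,dW_i(t),\quad Y_i(0)=0,\qquad dJ_i(t)=-\lambda_{J_i}^{-1}J_i(t)\,dt+d\Pi_i(t),\quad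 J_i(0)=0, \] and let the spot price be $P_t=f(t)+Y_1(t)+Y_2(t)+J_1(t)-J_2(t)$. Then for all $0\le t\le T$ the random variable $P_T$ is $\mathbb Q$-integrable, and the futures price $F(t,T)=\mathbb E^{\mathbb Q}[P_T\mid\mathcal F_t]$ is, almost surely, \[ \begin{aligned} F(t,T)=f(T)&+\sum_{i=1}^{2}\Bigl[Y_i(t)e^{-(T-t)/\lambda_{Y_i}}-\phi_i\lambda_{Y_i}\bigl(1-e^{-(T-t)/\lambda_{Y_i}}\bigr)\Bigr]\\ &+\Bigl[J_1(t)e^{-(T-t)/\lambda_{J_1}}+\frac{\theta_1}{\beta_1^*}\lambda_{J_1}\bigl(1-e^{-(T-t)/\lambda_{J_1}}\bigr)\Bigr]\\ &-\Bigl[J_2(t)e^{-(T-t)/\lambda_{J_2}}+\frac{\theta_2}{\beta_2^*}\lambda_{J_2}\bigl(1-e^{-(T-t)/\lambda_{J_2}}\bigr)\Bigr]. \end{aligned} \] -/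

import Mathlib

open MeasureTheory ProbabilityTheory
open scoped NNReal

/-- The increments of `Z` after time `s` are independent of the past `𝓕 s`. -/
def HasIncrementsIndepOfPast {Ω : Type*} {m : MeasurableSpace Ω} (Z : ℝ≥0 → Ω → ℝ)
    (𝓕 : Filtration ℝ≥0 m) (Q : Measure Ω) : Prop :=
  ∀ s t : ℝ≥0, s ≤ t →
    Indep (MeasurableSpace.comap (fun ω ↦ Z t ω - Z s ω) inferInstance) (𝓕 s) Q

/-- `W` is a standard `𝓕`-Brownian motion under `Q`. -/
structure IsFiltrationBrownian {Ω : Type*} {m : MeasurableSpace Ω} (W : ℝ≥0 → Ω → ℝ)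
    (𝓕 : Filtration ℝ≥0 m) (Q : Measure Ω) : Prop where
  brownian : IsBrownianReal W Q
  adapted : Adapted 𝓕 W
  indep_past : HasIncrementsIndepOfPast W 𝓕 Q

/-- `N` is a Poisson (counting) process with constant intensity `θ` under `Q`. -/
structure IsPoissonProcess {Ω : Type*} {m : MeasurableSpace Ω} (N : ℝ≥0 → Ω → ℕ)
    (θ : ℝ≥0) (Q : Measure Ω) : Prop where
  measurable : ∀ t, Measurable (N t)
  zero : ∀ᵐ ω ∂Q, N 0 ω = 0
  mono : ∀ᵐ ω ∂Q, Monotone (fun t ↦ N t ω)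
  rightCont : ∀ᵐ ω ∂Q, ∀ t, ContinuousWithinAt (fun u ↦ N u ω) (Set.Ici t) t
  indepIncrements : HasIndepIncrements (fun t ω ↦ (N t ω : ℝ)) Q
  law : ∀ s t : ℝ≥0, s ≤ t →
    HasLaw (fun ω ↦ N t ω - N s ω) (poissonMeasure (θ * (t - s))) Q

/-- `C` is an `𝓕`-compound Poisson process under `Q` with intensity `θ` and jump sizes
exponentially distributed with rate `β` (mean `1 / β`): `C t` is the sum of the first `N t` jump
sizes, where `N` is a Poisson process independent of the i.i.d. sequence `ξ` of jump sizes. -/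
structure IsExpCompoundPoisson {Ω : Type*} {m : MeasurableSpace Ω} (C : ℝ≥0 → Ω → ℝ)
    (θ : ℝ≥0) (β : ℝ) (𝓕 : Filtration ℝ≥0 m) (Q : Measure Ω) : Prop where
  adapted : Adapted 𝓕 C
  indep_past : HasIncrementsIndepOfPast C 𝓕 Q
  representation : ∃ (N : ℝ≥0 → Ω → ℕ) (ξ : ℕ → Ω → ℝ),
    IsPoissonProcess N θ Q ∧
    (∀ k, Measurable (ξ k)) ∧
    (∀ k, HasLaw (ξ k) (expMeasure β) Q) ∧
    iIndepFun ξ Q ∧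
    IndepFun (fun ω t ↦ N t ω) (fun ω k ↦ ξ k ω) Q ∧
    ∀ᵐ ω ∂Q, ∀ t, C t ω = ∑ k ∈ Finset.range (N t ω), ξ k ω

/-- `X` is a solution of `dX = (-lam⁻¹ X - φ) dt + dZ` with `X 0 = 0`: it is adapted and satisfies
the integral equation for all times almost surely. The noise is additive, so that the
stochastic integral `∫₀ᵗ dZ` is `Z t - Z 0`. The equation makes the paths of `X` as regular as
those of `Z` (continuous, resp. right-continuous with left limits). -/
structure IsOUSolution {Ω : Type*} {m : MeasurableSpace Ω} (lam φ : ℝ) (Z X : ℝ≥0 → Ω → ℝ)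
    (𝓕 : Filtration ℝ≥0 m) (Q : Measure Ω) : Prop where
  adapted : Adapted 𝓕 X
  zero : ∀ᵐ ω ∂Q, X 0 ω = 0
  integrable : ∀ᵐ ω ∂Q, ∀ t : ℝ≥0,
    IntervalIntegrable (fun s : ℝ ↦ X s.toNNReal ω) volume 0 t
  equation : ∀ᵐ ω ∂Q, ∀ t : ℝ≥0,
    X t ω = X 0 ω + (∫ s in (0 : ℝ)..t, (-lam⁻¹ * X s.toNNReal ω - φ)) + (Z t ω - Z 0 ω)

/-- The Gaussian Ornstein-Uhlenbeck dynamics `dY = (-lam⁻¹ Y - φ) dt + σ dW`, `Y 0 = 0`,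
driven by an `𝓕`-Brownian motion `W`. -/
structure IsGaussianOU {Ω : Type*} {m : MeasurableSpace Ω} (lam φ σ : ℝ) (W Y : ℝ≥0 → Ω → ℝ)
    (𝓕 : Filtration ℝ≥0 m) (Q : Measure Ω) : Prop where
  driver : IsFiltrationBrownian W 𝓕 Q
  solution : IsOUSolution lam φ (fun t ω ↦ σ * W t ω) Y 𝓕 Q

/-- The jump Ornstein-Uhlenbeck dynamics `dJ = -lam⁻¹ J dt + dC`, `J 0 = 0`, driven by an
`𝓕`-compound Poisson process `C` with intensity `θ` and exponential jump sizes of rate `β`. -/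
structure IsJumpOU {Ω : Type*} {m : MeasurableSpace Ω} (lam : ℝ) (θ : ℝ≥0) (β : ℝ)
    (C J : ℝ≥0 → Ω → ℝ) (𝓕 : Filtration ℝ≥0 m) (Q : Measure Ω) : Prop where
  driver : IsExpCompoundPoisson C θ β 𝓕 Q
  solution : IsOUSolution lam 0 C J 𝓕 Q

/-- The spot price `P t = f t + Y₁ t + Y₂ t + J₁ t - J₂ t` of the four-factor model. -/
def spotPrice {Ω : Type*} (f : ℝ≥0 → ℝ) (Y₁ Y₂ J₁ J₂ : ℝ≥0 → Ω → ℝ) : ℝ≥0 → Ω → ℝ :=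
  fun t ω ↦ f t + Y₁ t ω + Y₂ t ω + J₁ t ω - J₂ t ω

/-- The price at time `t` of the futures contract with maturity `T` on the spot price `P`,
`F(t, T) = E^Q[P T | 𝓕 t]`. -/
noncomputable def futuresPrice {Ω : Type*} {m : MeasurableSpace Ω} (Q : Measure Ω)
    (𝓕 : Filtration ℝ≥0 m) (P : ℝ≥0 → Ω → ℝ) (t T : ℝ≥0) : Ω → ℝ :=
  Q[P T | 𝓕 t]

/-! Conditional expectation is linear, so the factors are treated one at a time and no joint law of
the drivers enters. Each factor solves a linear equation with additive noise `Z`. Variation of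
constants, applied path by path, splits `X T` into the discounted value `exp (-a (T - t)) * X t` and
an innovation built from increments of `Z` after `t` (`IsOUSolution.ae_eq_ouInnovation`).
Integrating the noise by parts leaves only Lebesgue integrals, so no stochastic calculus is needed.
Increments are independent of the past, so by Fubini only their mean `c` per unit time counts: the
innovation has constant conditional mean (`IsDriftedNoise.setIntegral_ouInnovation`). Brownian noise
has `c = 0`; compound Poisson noise has `c = θ / β` by Wald's identity. -/

/-! ### Moments of the Poisson and exponential laws -/

lemma lintegral_natCast_poissonMeasure (r : ℝ≥0) :
    ∫⁻ n : ℕ, (n : ENNReal) ∂poissonMeasure r = r := by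
  have hsum : HasSum (fun n : ℕ ↦ (n : ℝ) * (Real.exp (-(r : ℝ)) * (r : ℝ) ^ n / (n.factorial : ℝ)))
      (r : ℝ) := by
    -- The term `n = 0` vanishes, and `n / n! = 1 / (n - 1)!` leaves `r` times the total mass.
    rw [← hasSum_nat_add_iff' 1]
    have h := (hasSum_one_poissonMeasure r).mul_left (r : ℝ)
    simp only [mul_one] at h
    simp only [Finset.range_one, Finset.sum_singleton, Nat.cast_zero, zero_mul, sub_zero]
    refine h.congr_fun fun n ↦ ?_
    rw [Nat.factorial_succ]
    push_cast
    have : (n.factorial : ℝ) ≠ 0 := by positivity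
    field_simp
    ring
  rw [poissonMeasure, lintegral_sum_measure]
  calc
    _ = ∑' n : ℕ, ENNReal.ofReal
        ((n : ℝ) * (Real.exp (-(r : ℝ)) * (r : ℝ) ^ n / (n.factorial : ℝ))) := by
      congr 1 with n
      rw [lintegral_smul_measure, lintegral_dirac, smul_eq_mul,
        ENNReal.ofReal_mul (by positivity), ENNReal.ofReal_natCast, mul_comm]
    _ = ENNReal.ofReal (r : ℝ) := by
      rw [← ENNReal.ofReal_tsum_of_nonneg (fun n ↦ by positivity) hsum.summable, hsum.tsum_eq]
    _ = r := ENNReal.ofReal_coe_nnreal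

lemma expMeasure_ae_nonneg (β : ℝ) : ∀ᵐ x ∂expMeasure β, 0 ≤ x := by
  have hmeas : Measurable (gammaPDF 1 β) := (measurable_gammaPDFReal 1 β).ennreal_ofReal
  rw [expMeasure, gammaMeasure, ae_withDensity_iff hmeas]
  refine .of_forall fun x hx ↦ ?_
  by_contra! h
  exact hx (gammaPDF_of_neg h)

lemma lintegral_ofReal_expMeasure {β : ℝ} (hβ : 0 < β) :
    ∫⁻ x, ENNReal.ofReal x ∂expMeasure β = ENNReal.ofReal β⁻¹ := by
  have hmeas (a : ℝ) : Measurable (gammaPDF a β) := (measurable_gammaPDFReal a β).ennreal_ofReal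
  rw [expMeasure, gammaMeasure,
    lintegral_withDensity_eq_lintegral_mul _ (hmeas 1) (by fun_prop)]
  calc
    -- Weighting the exponential density by `x` gives `β⁻¹` times the Gamma(2, β) density, whose
    -- mass is 1.
    _ = ∫⁻ x, ENNReal.ofReal β⁻¹ * gammaPDF 2 β x := by
      congr 1 with x
      rcases lt_or_ge x 0 with hx | hx
      · simp [gammaPDF_of_neg hx]
      · rw [Pi.mul_apply, gammaPDF_of_nonneg hx, gammaPDF_of_nonneg hx, mul_comm,
          ← ENNReal.ofReal_mul hx, ← ENNReal.ofReal_mul (by positivity)]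
        congr 1
        have h2 : (2 : ℝ) - 1 = 1 := by norm_num
        rw [sub_self, h2, Real.Gamma_one, Real.Gamma_two, Real.rpow_zero, Real.rpow_one,
          Real.rpow_one, Real.rpow_two]
        field_simp
    _ = _ := by
      rw [lintegral_const_mul _ (hmeas 2), lintegral_gammaPDF_eq_one two_pos hβ, mul_one]

/-! ### Path regularity and the pathwise linear equation -/

/-- If the paths of `f` are right-continuous, then `f` is jointly measurable up to a null set. -/
lemma aestronglyMeasurable_uncurry_of_rightContinuous {Ω : Type*} {m : MeasurableSpace Ω}
    {Q : Measure Ω} [SFinite Q] {μ : Measure ℝ} [SFinite μ] {f : ℝ → Ω → ℝ}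
    (hf : ∀ r, Measurable (f r))
    (hcont : ∀ᵐ ω ∂Q, ∀ r, ContinuousWithinAt (fun u ↦ f u ω) (Set.Ici r) r) :
    AEStronglyMeasurable (Function.uncurry f) (μ.prod Q) := by
  -- Time is rounded up to the grid of mesh `1 / (n + 1)`: countably many values, approaching `r`
  -- from the right.
  refine aestronglyMeasurable_of_tendsto_ae Filter.atTop
    (f := fun (n : ℕ) (p : ℝ × Ω) ↦ f ((⌊((n : ℝ) + 1) * p.1⌋ + 1) / ((n : ℝ) + 1)) p.2)
    (fun n ↦ ?_) ?_
  · have h : Measurable (fun p : ℤ × Ω ↦ f ((p.1 + 1) / ((n : ℝ) + 1)) p.2) :=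
      measurable_from_prod_countable_right fun k ↦ hf ((k + 1) / ((n : ℝ) + 1))
    have h' : Measurable (fun p : ℝ × Ω ↦ (⌊((n : ℝ) + 1) * p.1⌋, p.2)) := by fun_prop
    exact (h.comp h').aestronglyMeasurable
  · filter_upwards [Measure.quasiMeasurePreserving_snd.ae hcont] with p hp
    have hlow (n : ℕ) : p.1 ≤ (⌊((n : ℝ) + 1) * p.1⌋ + 1) / ((n : ℝ) + 1) := by
      rw [le_div_iff₀ (by positivity), mul_comm]
      exact (Int.lt_floor_add_one _).le
    have hup (n : ℕ) : (⌊((n : ℝ) + 1) * p.1⌋ + 1) / ((n : ℝ) + 1) ≤ p.1 + 1 / ((n : ℝ) + 1) := by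
      have hn : (n : ℝ) + 1 ≠ 0 := by positivity
      rw [div_le_iff₀ (by positivity), add_mul p.1, one_div_mul_cancel hn, mul_comm p.1]
      gcongr
      exact Int.floor_le _
    have hlim : Filter.Tendsto (fun n : ℕ ↦ p.1 + 1 / ((n : ℝ) + 1)) Filter.atTop (nhds p.1) := by
      simpa using tendsto_one_div_add_atTop_nhds_zero_nat.const_add p.1
    refine (hp p.1).tendsto.comp (tendsto_nhdsWithin_iff.2
      ⟨tendsto_of_tendsto_of_tendsto_of_le_of_le tendsto_const_nhds hlim hlow hup,
        .of_forall hlow⟩)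

/-- The variation of constants formula for `dx = (-a x - φ) dr + dz` with right-continuous `z`. -/
lemma variation_of_constants {x z : ℝ → ℝ} {a φ t T : ℝ} (htT : t ≤ T)
    (hx : IntervalIntegrable x volume t T)
    (hz : ∀ r ∈ Set.Ioo t T, ContinuousWithinAt z (Set.Ici r) r)
    (heq : ∀ r ∈ Set.Icc t T, x r = x t + (∫ s in t..r, (-a * x s - φ)) + (z r - z t)) :
    x T = Real.exp (-a * (T - t)) * x t + ((z T - z t)
      - ∫ r in t..T, Real.exp (-a * (T - r)) * (a * (z r - z t) + φ)) := by
  set g : ℝ → ℝ := fun s ↦ -a * x s - φ with hg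
  have hgi : IntervalIntegrable g volume t T := (hx.const_mul _).sub intervalIntegrable_const
  have hgi' : ∀ r ∈ Set.Icc t T, IntervalIntegrable g volume t r := fun r hr ↦
    hgi.mono_set (by rw [Set.uIcc_of_le htT, Set.uIcc_of_le hr.1]; exact Set.Icc_subset_Icc_right hr.2)
  -- `v` is `x` with the noise removed: continuous even where `z` jumps, with right derivative `g`.
  set v : ℝ → ℝ := fun r ↦ x t + ∫ s in t..r, g s with hv
  have hvc : ContinuousOn v (Set.Icc t T) := by
    have := intervalIntegral.continuousOn_primitive_interval (f := g) (a := t) (b := T) (μ := volume)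
      (by rw [Set.uIcc_of_le htT]; exact (intervalIntegrable_iff_integrableOn_Icc_of_le htT).1 hgi)
    rw [Set.uIcc_of_le htT] at this
    exact continuousOn_const.add this
  have hxr : ∀ r ∈ Set.Ioo t T, ContinuousWithinAt x (Set.Ioi r) r := by
    intro r hr
    have hvr : ContinuousWithinAt v (Set.Ioi r) r :=
      (hvc.continuousAt (Icc_mem_nhds hr.1 hr.2)).continuousWithinAt
    have h1 : ContinuousWithinAt (fun u ↦ v u + (z u - z t)) (Set.Ioi r) r :=
      hvr.add (((hz r hr).mono Set.Ioi_subset_Ici_self).sub continuousWithinAt_const)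
    refine h1.congr_of_eventuallyEq ?_ (heq r ⟨hr.1.le, hr.2.le⟩)
    filter_upwards [Ioo_mem_nhdsGT hr.2] with u hu
    exact heq u ⟨hr.1.le.trans hu.1.le, hu.2.le⟩
  have hvd : ∀ r ∈ Set.Ioo t T, HasDerivWithinAt v (g r) (Set.Ioi r) r := by
    intro r hr
    have hmeas : StronglyMeasurableAtFilter g (nhdsWithin r (Set.Ioi r)) volume :=
      ⟨Set.Ioo r T, Ioo_mem_nhdsGT hr.2,
        (((intervalIntegrable_iff_integrableOn_Ioo_of_le htT).1 hgi).mono_set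
          (Set.Ioo_subset_Ioo_left hr.1.le)).aestronglyMeasurable⟩
    have h1 := intervalIntegral.integral_hasDerivWithinAt_right (s := Set.Ici r) (t := Set.Ioi r)
      (hgi' r ⟨hr.1.le, hr.2.le⟩) hmeas
      ((continuousWithinAt_const.mul (hxr r hr)).sub continuousWithinAt_const)
    exact (h1.const_add (x t)).mono Set.Ioi_subset_Ici_self
  have hvi : IntervalIntegrable v volume t T := by
    refine ContinuousOn.intervalIntegrable ?_
    rwa [Set.uIcc_of_le htT]
  have hexp : Continuous fun r : ℝ ↦ Real.exp (-a * (T - r)) := by fun_prop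
  have key := intervalIntegral.integral_eq_sub_of_hasDeriv_right_of_le
    (f := fun r ↦ Real.exp (-a * (T - r)) * v r)
    (f' := fun r ↦ Real.exp (-a * (T - r)) * (a * v r + g r)) htT
    (hexp.continuousOn.mul hvc) (fun r hr ↦ by
      have h1 : HasDerivAt (fun r : ℝ ↦ Real.exp (-a * (T - r))) (Real.exp (-a * (T - r)) * a) r := by
        have := (((hasDerivAt_id r).const_sub T).const_mul (-a)).exp
        simpa using this
      refine (h1.hasDerivWithinAt.mul (hvd r hr)).congr_deriv ?_
      ring)
    (((hvi.const_mul a).add hgi).continuousOn_mul hexp.continuousOn)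
  -- Since `x = v + (z - z t)`, the unknown cancels from `a * v + g`.
  have hcongr : ∫ r in t..T, Real.exp (-a * (T - r)) * (a * v r + g r)
      = -∫ r in t..T, Real.exp (-a * (T - r)) * (a * (z r - z t) + φ) := by
    rw [← intervalIntegral.integral_neg]
    refine intervalIntegral.integral_congr fun r hr ↦ ?_
    rw [Set.uIcc_of_le htT] at hr
    have h1 : x r = v r + (z r - z t) := heq r hr
    simp only [hg, h1]
    ring
  have hT : x T = v T + (z T - z t) := heq T ⟨htT, le_rfl⟩
  have ht : v t = x t := by simp [hv]
  simp only [sub_self, mul_zero, Real.exp_zero, one_mul, ht] at key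
  rw [hT]
  linarith [key, hcongr]

/-! ### Noises with independent increments and linear mean -/

/-- `Z` is adapted and right-continuous with integrable increments that are independent of the past
and have mean `c` per unit of time. -/
structure IsDriftedNoise {Ω : Type*} {m : MeasurableSpace Ω} (Z : ℝ≥0 → Ω → ℝ) (c : ℝ)
    (𝓕 : Filtration ℝ≥0 m) (Q : Measure Ω) : Prop where
  adapted : Adapted 𝓕 Z
  indep_past : HasIncrementsIndepOfPast Z 𝓕 Q
  rightCont : ∀ᵐ ω ∂Q, ∀ t, ContinuousWithinAt (fun u ↦ Z u ω) (Set.Ici t) t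
  integrable : ∀ t, Integrable (Z t) Q
  mean : ∀ t : ℝ≥0, ∫ ω, Z t ω ∂Q = c * t
  bounded : ∀ T : ℝ≥0, ∃ K, ∀ t ≤ T, ∫ ω, |Z t ω| ∂Q ≤ K

section

variable {Ω : Type*} {m : MeasurableSpace Ω} {Q : Measure Ω} {𝓕 : Filtration ℝ≥0 m}

lemma IsFiltrationBrownian.isDriftedNoise [IsProbabilityMeasure Q] {W : ℝ≥0 → Ω → ℝ}
    (hW : IsFiltrationBrownian W 𝓕 Q) (σ : ℝ) :
    IsDriftedNoise (fun t ω ↦ σ * W t ω) 0 𝓕 Q := by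
  have hB := hW.brownian.toIsPreBrownianReal
  have hsq (t : ℝ≥0) : ∫ ω, (W t ω) ^ 2 ∂Q = t := by
    rw [← variance_of_integral_eq_zero (hB.aemeasurable t) (hB.integral_eval t),
      (hB.hasLaw_eval t).variance_eq, variance_id_gaussianReal]
  have hsqi (t : ℝ≥0) : Integrable (fun ω ↦ (W t ω) ^ 2) Q :=
    ((hB.isGaussianProcess.hasGaussianLaw_eval t).memLp_two).integrable_sq
  -- The bound `|σ| * (1 + T)` comes from `|w| ≤ 1 + w ^ 2` and `E (W t) ^ 2 = t`.
  refine ⟨fun t ↦ (hW.adapted t).const_mul σ, fun s t hst ↦ ?_, ?_,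
    fun t ↦ (hB.integrable_eval t).const_mul σ, fun t ↦ ?_, fun T ↦ ⟨|σ| * (1 + T), fun t ht ↦ ?_⟩⟩
  · refine indep_of_indep_of_le_left (hW.indep_past s t hst) ?_
    rintro _ ⟨u, hu, rfl⟩
    refine ⟨(fun x ↦ σ * x) ⁻¹' u, (measurable_const_mul σ) hu, ?_⟩
    ext ω
    simp [mul_sub]
  · filter_upwards [hW.brownian.cont] with ω hω t
    exact (continuous_const.mul hω).continuousWithinAt
  · rw [integral_const_mul, hB.integral_eval t]
    simp
  · simp only [abs_mul]
    rw [integral_const_mul]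
    gcongr
    calc
      ∫ ω, |W t ω| ∂Q ≤ ∫ ω, (1 + (W t ω) ^ 2) ∂Q := by
        refine integral_mono (hB.integrable_eval t).abs ((integrable_const 1).add (hsqi t)) fun ω ↦ ?_
        simp only
        nlinarith [sq_abs (W t ω), sq_nonneg (|W t ω| - 1), sq_nonneg (|W t ω|)]
      _ = 1 + t := by
        rw [integral_add (integrable_const 1) (hsqi t), hsq]
        simp
      _ ≤ 1 + T := by gcongr

/-- Wald's identity for a sum of a random number of nonnegative terms. -/
lemma lintegral_sum_range_eq_mul {N : Ω → ℕ} {ξ : ℕ → Ω → ENNReal} {b : ENNReal}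
    (hN : Measurable N) (hξ : ∀ k, Measurable (ξ k)) (hb : ∀ k, ∫⁻ ω, ξ k ω ∂Q = b)
    (hind : ∀ k, IndepFun N (ξ k) Q) :
    ∫⁻ ω, ∑ k ∈ Finset.range (N ω), ξ k ω ∂Q = (∫⁻ ω, (N ω : ENNReal) ∂Q) * b := by
  -- Indicators turn the random sum into a series whose terms factor by independence.
  set χ : ℕ → ℕ → ENNReal := fun k n ↦ if k < n then 1 else 0 with hχ
  have hχm (k : ℕ) : Measurable (χ k) := measurable_of_countable _
  have hsum (n : ℕ) (y : ℕ → ENNReal) :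
      ∑ k ∈ Finset.range n, y k = ∑' k, χ k n * y k := by
    rw [tsum_eq_sum (s := Finset.range n)]
    · exact Finset.sum_congr rfl fun k hk ↦ by simp [hχ, Finset.mem_range.1 hk]
    · intro k hk
      simp only [Finset.mem_range] at hk
      simp [hχ, hk]
  have hcard (n : ℕ) : (n : ENNReal) = ∑' k, χ k n := by
    simpa using hsum n fun _ ↦ 1
  calc
    _ = ∫⁻ ω, ∑' k, χ k (N ω) * ξ k ω ∂Q := by simp only [hsum]
    _ = ∑' k, ∫⁻ ω, χ k (N ω) * ξ k ω ∂Q :=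
      lintegral_tsum fun k ↦ (((hχm k).comp hN).mul (hξ k)).aemeasurable
    _ = ∑' k, (∫⁻ ω, χ k (N ω) ∂Q) * b := by
      congr 1 with k
      rw [← hb k]
      exact lintegral_mul_eq_lintegral_mul_lintegral_of_indepFun''
        ((hχm k).comp hN).aemeasurable (hξ k).aemeasurable ((hind k).comp (hχm k) measurable_id)
    _ = _ := by
      rw [ENNReal.tsum_mul_right]
      simp only [hcard]
      rw [lintegral_tsum (f := fun k ω ↦ χ k (N ω)) fun k ↦ ((hχm k).comp hN).aemeasurable]

lemma IsPoissonProcess.lintegral_natCast {N : ℝ≥0 → Ω → ℕ} {θ : ℝ≥0}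
    (hN : IsPoissonProcess N θ Q) (t : ℝ≥0) :
    ∫⁻ ω, (N t ω : ENNReal) ∂Q = θ * t := by
  have h := (hN.law 0 t zero_le).lintegral_comp (f := fun n : ℕ ↦ (n : ENNReal))
    (measurable_of_countable _).aemeasurable
  rw [lintegral_natCast_poissonMeasure, tsub_zero] at h
  push_cast at h
  rw [← h]
  refine lintegral_congr_ae ?_
  filter_upwards [hN.zero] with ω hω
  simp [hω]

/-- Jumps are almost surely nonnegative, so one Wald computation gives integrability, mean and the
bound together. -/
lemma IsExpCompoundPoisson.isDriftedNoise [IsProbabilityMeasure Q] {C : ℝ≥0 → Ω → ℝ} {θ : ℝ≥0}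
    {β : ℝ} (hβ : 0 < β) (hC : IsExpCompoundPoisson C θ β 𝓕 Q) :
    IsDriftedNoise C (θ / β) 𝓕 Q := by
  obtain ⟨N, ξ, hN, hξm, hξlaw, -, hind, hrep⟩ := hC.representation
  have hξ0 : ∀ᵐ ω ∂Q, ∀ k, 0 ≤ ξ k ω := by
    refine ae_all_iff.2 fun k ↦ ?_
    have h := expMeasure_ae_nonneg β
    rw [← (hξlaw k).map_eq] at h
    exact ae_of_ae_map (hξm k).aemeasurable h
  have hCm (t : ℝ≥0) : Measurable (C t) := (hC.adapted t).mono (𝓕.le t) le_rfl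
  have hC0 (t : ℝ≥0) : 0 ≤ᵐ[Q] C t := by
    filter_upwards [hξ0, hrep] with ω h1 h2
    rw [h2 t]
    exact Finset.sum_nonneg fun k _ ↦ h1 k
  have hlin (t : ℝ≥0) : ∫⁻ ω, ENNReal.ofReal (C t ω) ∂Q = ENNReal.ofReal (θ / β * t) := by
    calc
      _ = ∫⁻ ω, ∑ k ∈ Finset.range (N t ω), ENNReal.ofReal (ξ k ω) ∂Q := by
        refine lintegral_congr_ae ?_
        filter_upwards [hξ0, hrep] with ω h1 h2
        rw [h2 t, ENNReal.ofReal_sum_of_nonneg fun k _ ↦ h1 k]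
      _ = (θ * t) * ENNReal.ofReal β⁻¹ := by
        rw [lintegral_sum_range_eq_mul (b := ENNReal.ofReal β⁻¹) (hN.measurable t)
          (fun k ↦ (hξm k).ennreal_ofReal), hN.lintegral_natCast]
        · intro k
          rw [(hξlaw k).lintegral_comp (f := ENNReal.ofReal) (by fun_prop),
            lintegral_ofReal_expMeasure hβ]
        · intro k
          exact hind.comp (measurable_pi_apply t)
            (ENNReal.measurable_ofReal.comp (measurable_pi_apply k))
      _ = _ := by
        rw [← ENNReal.ofReal_coe_nnreal, ← ENNReal.ofReal_coe_nnreal,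
          ← ENNReal.ofReal_mul (by positivity), ← ENNReal.ofReal_mul (by positivity)]
        congr 1
        ring
  have hint (t : ℝ≥0) : Integrable (C t) Q := by
    refine ⟨(hCm t).aestronglyMeasurable, ?_⟩
    rw [hasFiniteIntegral_iff_ofReal (hC0 t), hlin]
    exact ENNReal.ofReal_lt_top
  have hmean (t : ℝ≥0) : ∫ ω, C t ω ∂Q = θ / β * t := by
    rw [integral_eq_lintegral_of_nonneg_ae (hC0 t) (hCm t).aestronglyMeasurable, hlin,
      ENNReal.toReal_ofReal (by positivity)]
  refine ⟨hC.adapted, hC.indep_past, ?_, hint, hmean, fun T ↦ ⟨θ / β * T, fun t ht ↦ ?_⟩⟩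
  · filter_upwards [hrep, hN.rightCont] with ω h1 h2 t
    simp only [h1]
    -- Partial sums are continuous in the discrete variable `n`, so `C` inherits right-continuity
    -- from `N`.
    exact ContinuousAt.comp_continuousWithinAt (f := fun u ↦ N u ω)
      (g := fun n : ℕ ↦ ∑ k ∈ Finset.range n, ξ k ω) continuous_of_discreteTopology.continuousAt (h2 t)
  · calc
      ∫ ω, |C t ω| ∂Q = ∫ ω, C t ω ∂Q := by
        refine integral_congr_ae ?_
        filter_upwards [hC0 t] with ω hω using abs_of_nonneg hω
      _ = θ / β * t := hmean t
      _ ≤ θ / β * T := by gcongr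

end

/-! ### Conditional mean of an Ornstein-Uhlenbeck factor -/

section

variable {Ω : Type*} {m : MeasurableSpace Ω} {Q : Measure Ω} {𝓕 : Filtration ℝ≥0 m}
  {Z X : ℝ≥0 → Ω → ℝ} {c : ℝ}

lemma IsDriftedNoise.measurable (hZ : IsDriftedNoise Z c 𝓕 Q) (t : ℝ≥0) : Measurable (Z t) :=
  (hZ.adapted t).mono (𝓕.le t) le_rfl

lemma IsDriftedNoise.setIntegral_sub [IsProbabilityMeasure Q] (hZ : IsDriftedNoise Z c 𝓕 Q)
    {s t : ℝ≥0} (hst : s ≤ t) {A : Set Ω} (hA : MeasurableSet[𝓕 s] A) :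
    ∫ ω in A, (Z t ω - Z s ω) ∂Q = Q.real A * (c * ((t : ℝ) - s)) := by
  have hint : Integrable (fun ω ↦ Z t ω - Z s ω) Q := (hZ.integrable t).sub (hZ.integrable s)
  have hce : Q[fun ω ↦ Z t ω - Z s ω | 𝓕 s] =ᵐ[Q] fun _ ↦ ∫ ω, (Z t ω - Z s ω) ∂Q :=
    condExp_indep_eq ((hZ.measurable t).sub (hZ.measurable s)).comap_le (𝓕.le s)
      (comap_measurable _).stronglyMeasurable (hZ.indep_past s t hst)
  rw [← setIntegral_condExp (𝓕.le s) hint hA,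
    setIntegral_congr_ae (𝓕.le s A hA) (hce.mono fun ω h _ ↦ h), setIntegral_const,
    integral_sub (hZ.integrable t) (hZ.integrable s), hZ.mean, hZ.mean, smul_eq_mul]
  ring

/-- This licenses Fubini; it rests on the bound of `E |Z r|` uniform in `r ≤ T`. -/
lemma IsDriftedNoise.integrable_uncurry [IsProbabilityMeasure Q] (hZ : IsDriftedNoise Z c 𝓕 Q)
    (a φ : ℝ) (t T : ℝ≥0) :
    Integrable (Function.uncurry fun (r : ℝ) (ω : Ω) ↦
        Real.exp (-a * ((T : ℝ) - r)) * (a * (Z r.toNNReal ω - Z t ω) + φ))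
      ((volume.restrict (Set.Ioc (t : ℝ) T)).prod Q) := by
  set μ : Measure ℝ := volume.restrict (Set.Ioc (t : ℝ) T)
  have hmeas : AEStronglyMeasurable (Function.uncurry fun (r : ℝ) (ω : Ω) ↦ Z r.toNNReal ω)
      (μ.prod Q) := by
    refine aestronglyMeasurable_uncurry_of_rightContinuous (fun r ↦ hZ.measurable _) ?_
    filter_upwards [hZ.rightCont] with ω hω r
    exact (hω r.toNNReal).comp continuous_real_toNNReal.continuousWithinAt
      fun u hu ↦ Real.toNNReal_le_toNNReal hu
  have hZint : Integrable (Function.uncurry fun (r : ℝ) (ω : Ω) ↦ Z r.toNNReal ω) (μ.prod Q) := by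
    rw [integrable_prod_iff hmeas]
    refine ⟨.of_forall fun r ↦ hZ.integrable r.toNNReal, ?_⟩
    obtain ⟨K, hK⟩ := hZ.bounded T
    refine (integrable_const K).mono' hmeas.norm.integral_prod_right' ?_
    refine (ae_restrict_iff' measurableSet_Ioc).2 (.of_forall fun r hr ↦ ?_)
    rw [Real.norm_of_nonneg (integral_nonneg fun ω ↦ norm_nonneg _)]
    exact hK _ (Real.toNNReal_le_iff_le_coe.2 hr.2)
  have hsum : Integrable (fun p : ℝ × Ω ↦ a * (Z p.1.toNNReal p.2 - Z t p.2) + φ) (μ.prod Q) :=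
    ((hZint.sub ((hZ.integrable t).comp_snd μ)).const_mul a).add (integrable_const φ)
  refine hsum.bdd_mul (c := Real.exp (|a| * (T - t)))
    (f := fun p : ℝ × Ω ↦ Real.exp (-a * ((T : ℝ) - p.1)))
    (by fun_prop) ?_
  have hr : ∀ᵐ r ∂μ, r ∈ Set.Ioc (t : ℝ) T := ae_restrict_mem measurableSet_Ioc
  filter_upwards [Measure.quasiMeasurePreserving_fst.ae hr] with p hp
  rw [Real.norm_of_nonneg (Real.exp_pos _).le, Real.exp_le_exp]
  have h1 : -a ≤ |a| := neg_le_abs a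
  have h2 : 0 ≤ (T : ℝ) - p.1 := sub_nonneg.2 hp.2
  calc
    -a * ((T : ℝ) - p.1) ≤ |a| * ((T : ℝ) - p.1) := by gcongr
    _ ≤ |a| * (T - t) := by gcongr; exact hp.1.le

/-- The stochastic convolution over `[t, T]` of the noise `Z` and the drift `-φ` with the kernel
`exp (-a (T - r))`, written with the noise integrated by parts. -/
noncomputable def ouInnovation (a φ : ℝ) (Z : ℝ≥0 → Ω → ℝ) (t T : ℝ≥0) (ω : Ω) : ℝ :=
  (Z T ω - Z t ω)
    - ∫ r in (t : ℝ)..T, Real.exp (-a * ((T : ℝ) - r)) * (a * (Z r.toNNReal ω - Z t ω) + φ)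

lemma integral_exp_mul_affine {a : ℝ} (ha : a ≠ 0) (c φ t T : ℝ) :
    ∫ r in t..T, Real.exp (-a * (T - r)) * (a * (c * (r - t)) + φ)
      = c * (T - t) - (c - φ) / a * (1 - Real.exp (-a * (T - t))) := by
  have hderiv (r : ℝ) : HasDerivAt
      (fun r ↦ Real.exp (-a * (T - r)) * (c * (r - t) - (c - φ) / a))
      (Real.exp (-a * (T - r)) * (a * (c * (r - t)) + φ)) r := by
    have h1 : HasDerivAt (fun r : ℝ ↦ Real.exp (-a * (T - r))) (Real.exp (-a * (T - r)) * a) r := by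
      simpa using (((hasDerivAt_id r).const_sub T).const_mul (-a)).exp
    have h2 : HasDerivAt (fun r : ℝ ↦ c * (r - t) - (c - φ) / a) c r := by
      simpa using (((hasDerivAt_id r).sub_const t).const_mul c).sub_const ((c - φ) / a)
    refine (h1.mul h2).congr_deriv ?_
    field_simp
    ring
  rw [intervalIntegral.integral_eq_sub_of_hasDerivAt (fun r _ ↦ hderiv r)
    (Continuous.intervalIntegrable (by fun_prop) _ _)]
  simp only [sub_self, mul_zero, Real.exp_zero]
  ring

lemma IsDriftedNoise.integrable_ouInnovation [IsProbabilityMeasure Q]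
    (hZ : IsDriftedNoise Z c 𝓕 Q) (a φ : ℝ) {t T : ℝ≥0} (htT : t ≤ T) :
    Integrable (ouInnovation a φ Z t T) Q := by
  unfold ouInnovation
  refine ((hZ.integrable T).sub (hZ.integrable t)).sub ?_
  simp only [intervalIntegral.integral_of_le (NNReal.coe_le_coe.2 htT)]
  exact (hZ.integrable_uncurry a φ t T).integral_prod_right

/-- After Fubini each increment is replaced by its mean; the `c * (T - t)` of the boundary term then
cancels. -/
lemma IsDriftedNoise.setIntegral_ouInnovation [IsProbabilityMeasure Q]
    (hZ : IsDriftedNoise Z c 𝓕 Q) {a : ℝ} (ha : a ≠ 0) (φ : ℝ) {t T : ℝ≥0} (htT : t ≤ T)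
    {A : Set Ω} (hA : MeasurableSet[𝓕 t] A) :
    ∫ ω in A, ouInnovation a φ Z t T ω ∂Q
      = Q.real A * ((c - φ) / a * (1 - Real.exp (-a * ((T : ℝ) - t)))) := by
  have htT' : (t : ℝ) ≤ T := NNReal.coe_le_coe.2 htT
  have hprod := hZ.integrable_uncurry a φ t T
  have hprodA : Integrable (Function.uncurry fun (r : ℝ) (ω : Ω) ↦
        Real.exp (-a * ((T : ℝ) - r)) * (a * (Z r.toNNReal ω - Z t ω) + φ))
      ((volume.restrict (Set.Ioc (t : ℝ) T)).prod (Q.restrict A)) :=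
    hprod.mono_measure (Measure.prod_mono le_rfl Measure.restrict_le_self)
  have hdiff (r : ℝ≥0) : Integrable (fun ω ↦ Z r ω - Z t ω) Q :=
    (hZ.integrable r).sub (hZ.integrable t)
  have hswap : ∫ ω in A, (∫ r in (t : ℝ)..T,
        Real.exp (-a * ((T : ℝ) - r)) * (a * (Z r.toNNReal ω - Z t ω) + φ)) ∂Q
      = Q.real A * (c * ((T : ℝ) - t) - (c - φ) / a * (1 - Real.exp (-a * ((T : ℝ) - t)))) := by
    rw [← integral_exp_mul_affine ha, ← intervalIntegral.integral_const_mul]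
    simp only [intervalIntegral.integral_of_le htT']
    rw [← integral_integral_swap hprodA]
    refine setIntegral_congr_fun measurableSet_Ioc fun r hr ↦ ?_
    have htr : t ≤ r.toNNReal := NNReal.le_toNNReal_of_coe_le hr.1.le
    rw [integral_const_mul, integral_add ((hdiff _).integrableOn.const_mul a) (integrable_const φ),
      integral_const_mul, hZ.setIntegral_sub htr hA, setIntegral_const, smul_eq_mul,
      Real.coe_toNNReal r (t.coe_nonneg.trans hr.1.le)]
    ring
  unfold ouInnovation
  rw [integral_sub (hdiff T).integrableOn, hZ.setIntegral_sub htT hA, hswap]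
  · ring
  · simp only [intervalIntegral.integral_of_le htT']
    exact hprodA.integral_prod_right

lemma IsOUSolution.ae_eq_ouInnovation {lam φ : ℝ} (hZ : IsDriftedNoise Z c 𝓕 Q)
    (hX : IsOUSolution lam φ Z X 𝓕 Q) {t T : ℝ≥0} (htT : t ≤ T) :
    X T =ᵐ[Q] fun ω ↦ Real.exp (-lam⁻¹ * ((T : ℝ) - t)) * X t ω
      + ouInnovation lam⁻¹ φ Z t T ω := by
  filter_upwards [hX.integrable, hX.equation, hZ.rightCont] with ω hint heq hcont
  have hdrift (r : ℝ≥0) :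
      IntervalIntegrable (fun s : ℝ ↦ -lam⁻¹ * X s.toNNReal ω - φ) volume 0 r :=
    ((hint r).const_mul _).sub intervalIntegrable_const
  have h := variation_of_constants (x := fun s ↦ X s.toNNReal ω) (z := fun s ↦ Z s.toNNReal ω)
    (a := lam⁻¹) (φ := φ) (NNReal.coe_le_coe.2 htT) ((hint t).symm.trans (hint T))
    (fun r _ ↦ (hcont r.toNNReal).comp continuous_real_toNNReal.continuousWithinAt
      fun u hu ↦ Real.toNNReal_le_toNNReal hu)
    (fun r hr ↦ by
      lift r to ℝ≥0 using t.coe_nonneg.trans hr.1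
      simp only [Real.toNNReal_coe]
      -- Subtracting the equations at `r` and `t` restarts the dynamics at time `t`.
      rw [← intervalIntegral.integral_interval_sub_left (hdrift r) (hdrift t)]
      linarith [heq r, heq t])
  simpa only [Real.toNNReal_coe, ouInnovation] using h

lemma IsOUSolution.integrable_eval [IsProbabilityMeasure Q] {lam φ : ℝ} (hZ : IsDriftedNoise Z c 𝓕 Q)
    (hX : IsOUSolution lam φ Z X 𝓕 Q) (t : ℝ≥0) : Integrable (X t) Q := by
  refine (hZ.integrable_ouInnovation lam⁻¹ φ (zero_le (a := t))).congr ?_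
  filter_upwards [hX.ae_eq_ouInnovation hZ (zero_le (a := t)), hX.zero] with ω h1 h2
  rw [h1, h2, mul_zero, zero_add]

lemma IsOUSolution.condExp_ae_eq [IsProbabilityMeasure Q] {lam φ : ℝ} (hlam : lam ≠ 0)
    (hZ : IsDriftedNoise Z c 𝓕 Q) (hX : IsOUSolution lam φ Z X 𝓕 Q) {t T : ℝ≥0} (htT : t ≤ T) :
    Q[X T | 𝓕 t] =ᵐ[Q] fun ω ↦ X t ω * Real.exp (-lam⁻¹ * ((T : ℝ) - t))
      + (c - φ) / lam⁻¹ * (1 - Real.exp (-lam⁻¹ * ((T : ℝ) - t))) := by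
  have hXt : Integrable (fun ω ↦ X t ω * Real.exp (-lam⁻¹ * ((T : ℝ) - t))) Q :=
    (hX.integrable_eval hZ t).mul_const _
  have hM := hZ.integrable_ouInnovation lam⁻¹ φ htT
  refine (ae_eq_condExp_of_forall_setIntegral_eq (𝓕.le t) (hX.integrable_eval hZ T)
    (fun A _ _ ↦ (hXt.add (integrable_const _)).integrableOn) (fun A hA _ ↦ ?_) ?_).symm
  · rw [setIntegral_congr_ae (𝓕.le t A hA)
      ((hX.ae_eq_ouInnovation hZ htT).mono fun ω h _ ↦ h),
      integral_add' hXt.integrableOn (integrable_const _),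
      integral_add ((hX.integrable_eval hZ t).const_mul _).integrableOn hM.integrableOn,
      hZ.setIntegral_ouInnovation (inv_ne_zero hlam) φ htT hA, setIntegral_const, smul_eq_mul]
    simp only [mul_comm (X t _)]
  · exact (((hX.adapted t).mul_const _).add_const _).aestronglyMeasurable

end

/-! ### The futures price -/

theorem theorem1 {Ω : Type*} {m : MeasurableSpace Ω} (Q : Measure Ω) [IsProbabilityMeasure Q]
    (𝓕 : Filtration ℝ≥0 m) (f : ℝ≥0 → ℝ)
    (lamY₁ lamY₂ lamJ₁ lamJ₂ φ₁ φ₂ σ₁ σ₂ : ℝ) (θ₁ θ₂ : ℝ≥0) (β₁ β₂ : ℝ)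
    (hlamY₁ : 0 < lamY₁) (hlamY₂ : 0 < lamY₂) (hlamJ₁ : 0 < lamJ₁) (hlamJ₂ : 0 < lamJ₂)
    (hβ₁ : 0 < β₁) (hβ₂ : 0 < β₂)
    (W₁ W₂ C₁ C₂ Y₁ Y₂ J₁ J₂ : ℝ≥0 → Ω → ℝ)
    (hY₁ : IsGaussianOU lamY₁ φ₁ σ₁ W₁ Y₁ 𝓕 Q)
    (hY₂ : IsGaussianOU lamY₂ φ₂ σ₂ W₂ Y₂ 𝓕 Q)
    (hJ₁ : IsJumpOU lamJ₁ θ₁ β₁ C₁ J₁ 𝓕 Q)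
    (hJ₂ : IsJumpOU lamJ₂ θ₂ β₂ C₂ J₂ 𝓕 Q)
    (t T : ℝ≥0) (htT : t ≤ T) :
    Integrable (spotPrice f Y₁ Y₂ J₁ J₂ T) Q ∧
    futuresPrice Q 𝓕 (spotPrice f Y₁ Y₂ J₁ J₂) t T =ᵐ[Q] fun ω ↦
      f T
      + (Y₁ t ω * Real.exp (-lamY₁⁻¹ * ((T : ℝ) - t))
          - φ₁ / lamY₁⁻¹ * (1 - Real.exp (-lamY₁⁻¹ * ((T : ℝ) - t))))
      + (Y₂ t ω * Real.exp (-lamY₂⁻¹ * ((T : ℝ) - t))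
          - φ₂ / lamY₂⁻¹ * (1 - Real.exp (-lamY₂⁻¹ * ((T : ℝ) - t))))
      + (J₁ t ω * Real.exp (-lamJ₁⁻¹ * ((T : ℝ) - t))
          + (θ₁ : ℝ) / β₁ * lamJ₁ * (1 - Real.exp (-lamJ₁⁻¹ * ((T : ℝ) - t))))
      - (J₂ t ω * Real.exp (-lamJ₂⁻¹ * ((T : ℝ) - t))
          + (θ₂ : ℝ) / β₂ * lamJ₂ * (1 - Real.exp (-lamJ₂⁻¹ * ((T : ℝ) - t)))) := by
  have nY₁ := hY₁.driver.isDriftedNoise σ₁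
  have nY₂ := hY₂.driver.isDriftedNoise σ₂
  have nJ₁ := hJ₁.driver.isDriftedNoise hβ₁
  have nJ₂ := hJ₂.driver.isDriftedNoise hβ₂
  have iY₁ := hY₁.solution.integrable_eval nY₁ T
  have iY₂ := hY₂.solution.integrable_eval nY₂ T
  have iJ₁ := hJ₁.solution.integrable_eval nJ₁ T
  have iJ₂ := hJ₂.solution.integrable_eval nJ₂ T
  have hP : spotPrice f Y₁ Y₂ J₁ J₂ T = (fun _ ↦ f T) + Y₁ T + Y₂ T + J₁ T - J₂ T := rfl
  have if1 := (integrable_const (μ := Q) (f T)).add iY₁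
  refine ⟨hP ▸ ((if1.add iY₂).add iJ₁).sub iJ₂, ?_⟩
  rw [futuresPrice, hP]
  filter_upwards [condExp_sub ((if1.add iY₂).add iJ₁) iJ₂ (𝓕 t),
    condExp_add (if1.add iY₂) iJ₁ (𝓕 t), condExp_add if1 iY₂ (𝓕 t),
    condExp_add (integrable_const (μ := Q) (f T)) iY₁ (𝓕 t),
    hY₁.solution.condExp_ae_eq hlamY₁.ne' nY₁ htT, hY₂.solution.condExp_ae_eq hlamY₂.ne' nY₂ htT,
    hJ₁.solution.condExp_ae_eq hlamJ₁.ne' nJ₁ htT, hJ₂.solution.condExp_ae_eq hlamJ₂.ne' nJ₂ htT]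
    with ω h1 h2 h3 h4 hy₁ hy₂ hj₁ hj₂
  simp only [Pi.add_apply, Pi.sub_apply] at h1 h2 h3 h4
  rw [h1, h2, h3, h4, condExp_const (𝓕.le t), hy₁, hy₂, hj₁, hj₂]
  -- The mean `c - φ` is `0 - φ` for the Gaussian factors and `θ / β - 0` for the jump factors.
  simp only [sub_zero, zero_sub, div_inv_eq_mul]
  ring
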